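/- **Galois correspondence for coverings of $2$-complexes.** *Complexes.* A graph has a non-empty vertex set, an edge set, a start map $s$ from edges to vertices and an involution $e\mapsto e^{-1}$ on edges with $e^{-1}\neq e$; the terminal vertex of $e$ is $s(e^{-1})$. A (combinatorial) $2$-complex $X$ is a graph $X^{(1)}$ together with a set of faces carrying an involution $\sigma\mapsto\sigma^{-1}$ with $\sigma^{-1}\ne\sigma$, and for each face $\sigma$ a boundary $\partial\sigma=(X^\sigma,\alpha_\sigma)$, where $X^\sigma$ is a $1$-sphere (a cycle with $n\ge 1$ vertices $v_0,\dots,v_{n-1}$ and its standard orientation, or a single vertex) and $\alpha_\sigma:X^\sigma\to X^{(1)}$ is a dimension-preserving graph map, such that $\partial(\sigma^{-1})=(X^\sigma,\alpha_\sigma\iota)$ with $\iota$ the reflection $v_i\mapsto v_{-i}$. A dimension-preserving map $f:Y\to X$ sends vertices, edges and faces to vertices, edges and faces, commutes with $s$ and with inverses, and comes with orientation-preserving isomorphisms $\varepsilon(f,\sigma):Y^\sigma\to X^{f(\sigma)}$ satisfying $f\alpha_\sigma=\alpha_{f(\sigma)}\varepsilon(f,\sigma)$ and $\varepsilon(f,\sigma^{-1})=\iota\,\varepsilon(f,\sigma)\,\iota$.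 Two maps are equal when they agree on all cells and have the same $\varepsilon$'s; composites satisfy $\varepsilon(gf,\sigma)=\varepsilon(g,f(\sigma))\varepsilon(f,\sigma)$. An isomorphism is an invertible such map. A complex is connected if any two vertices are joined by an edge path. *Coverings.* A dimension-preserving map $f:Y\to X$ is a covering if for every vertex $w$ of $Y$ it restricts to a bijection from the edges starting at $w$ to the edges starting at $f(w)$ and, for every face $\tau$ of $X$, $\coprod_{f(\sigma)=\tau}\varepsilon(f,\sigma)$ is a bijection $\coprod_{f(\sigma)=\tau}\alpha_\sigma^{-1}(w)\to\alpha_\tau^{-1}(f(w))$. Its Galois group $\mathrm{Gal}(Y,X)$ consists of the automorphisms $a$ of $Y$ with $fa=f$. It is Galois via a vertex $v$ of $X$ if $\mathrm{Gal}(Y,X)$ acts regularly on the fibre $f^{-1}(v)$. It has degree $\kappa$ if every fibre (over a vertex, an edge or a face) has cardinality $\kappa$. *Intermediate coverings.* Let $f:Y_u\to X_v$ be a pointed covering of connected $2$-complexes. An intermediate covering $Y_u\xrightarrow{g}Z_x\xrightarrow{h}X_v$ consists of a connected $2$-complex $Z$ with a vertex $x$ and pointed coverings $g,h$ with $hg=f$.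 Two of them are equivalent if there is a pointed isomorphism $Z_x\cong Z'_{x'}$ commuting with the coverings from $Y$ and to $X$. Let $\mathcal L$ be the set of equivalence classes, ordered by $[Z]\le[Z']$ iff there is a pointed covering $Z'\to Z$ commuting with the coverings from $Y$ and to $X$. Then $\mathrm{Gal}(Y,Z)$ is a subgroup of $\mathrm{Gal}(Y,X)$ depending only on the class of $Z$. For a subgroup $H\subset\mathrm{Gal}(Y,X)$, let $Y/H$ be the quotient complex whose cells are the $H$-orbits of cells of $Y$, with quotient map $q$; the boundary of $[\sigma]$ is $q\alpha_\sigma$, up to the labelling of the $1$-sphere. It gives an intermediate covering $Y_u\to (Y/H)_{q(u)}\to X_v$. Let $\mathcal S$ be the lattice of subgroups of $\mathrm{Gal}(Y,X)$, ordered by inclusion. **Theorem.** Suppose that $f:Y_u\to X_v$ is a covering of connected $2$-complexes that is Galois via $v$. Then the poset $\mathcal L$ is a lattice, and the map $\Phi:\mathcal L\to\mathcal S$, $[Y\to Z\to X]\mapsto\mathrm{Gal}(Y,Z)$, is a lattice anti-isomorphism: a bijection with $a\le b\iff\Phi(b)\subset\Phi(a)$, and hence $\Phi(a\vee b)=\Phi(a)\cap\Phi(b)$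 and $\Phi(a\wedge b)=\langle\Phi(a),\Phi(b)\rangle$. Its inverse sends $H$ to the class of $Y_u\to (Y/H)_{q(u)}\to X_v$. Moreover: 1. $\mathrm{Gal}(Y,Y/H)=H$ for every subgroup $H$, and every intermediate covering $Y_u\to Z_x\to X_v$ is equivalent to $Y_u\to (Y/\mathrm{Gal}(Y,Z))_{q(u)}\to X_v$. 2. For an intermediate covering and any vertex $w$ of $X$, the covering $Z\to X$ is Galois via $w$ if and only if $\mathrm{Gal}(Y,Z)$ is a normal subgroup of $\mathrm{Gal}(Y,X)$. 3. For every intermediate covering, $\deg(Z\to X)=[\mathrm{Gal}(Y,X):\mathrm{Gal}(Y,Z)]$, as cardinals. 4. For every subgroup $H$ of $\mathrm{Gal}(Y,X)$, $\deg(Y/H\to X)=[\mathrm{Gal}(Y,X):H]$, as cardinals. -/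

import Mathlib

universe u v w

open CategoryTheory

namespace CombTop

/-! ### Graphs (1-complexes) -/

/-- A graph (1-complex) in the sense of Serre: vertices, oriented edges, a start map, and a
fixed-point-free involution `inv` sending an edge to its inverse. -/
structure Graph where
  V : Type u
  E : Type u
  nonempty_V : Nonempty V
  src : E → V
  inv : E → E
  inv_inv : ∀ e, inv (inv e) = e
  inv_ne : ∀ e, inv e ≠ e

namespace Graph

/-- The terminal vertex of an edge. -/
def tgt (G : Graph.{u}) (e : G.E) : G.V := G.src (G.inv e)

/-- Any two vertices are joined by a (possibly trivial) edge path. -/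
def Connected (G : Graph.{u}) : Prop :=
  ∀ a b : G.V, Relation.ReflTransGen (fun x y => ∃ e, G.src e = x ∧ G.tgt e = y) a b

/-- Dimension preserving maps of graphs. -/
@[ext]
structure Hom (G : Graph.{u}) (H : Graph.{v}) where
  onV : G.V → H.V
  onE : G.E → H.E
  src_comm : ∀ e, H.src (onE e) = onV (G.src e)
  inv_comm : ∀ e, onE (G.inv e) = H.inv (onE e)

/-- Composition, in diagrammatic order. -/
def Hom.comp {G : Graph.{u}} {H : Graph.{v}} {K : Graph.{w}} (f : Hom G H) (g : Hom H K) :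
    Hom G K where
  onV x := g.onV (f.onV x)
  onE e := g.onE (f.onE e)
  src_comm e := by rw [g.src_comm, f.src_comm]
  inv_comm e := by rw [f.inv_comm, g.inv_comm]

end Graph

/-! ### Standard 1-spheres -/

/-- The standard 1-sphere with `n` arcs.  For `n ≥ 1` it is the `n`-cycle with vertices
`v_0, …, v_{n-1}`, positive edges `e_i = (i, true)` from `v_i` to `v_{i+1}` (indices modulo `n`)
and inverse edges `(i, false)`; for `n = 0` it is the trivial graph (one vertex, no edges).
The positive edges form its standard orientation. -/
def oneSphere (n : ℕ) : Graph.{0} where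
  V := ZMod (max n 1)
  E := Fin n × Bool
  nonempty_V := ⟨0⟩
  src e := if e.2 then ((e.1 : ℕ) : ZMod (max n 1)) else ((e.1 : ℕ) : ZMod (max n 1)) + 1
  inv e := (e.1, !e.2)
  inv_inv e := by simp
  inv_ne e h := by
    have := congrArg Prod.snd h
    simp at this

/-- The reflection `ι` of the standard 1-sphere: `v_i ↦ v_{-i}`, and it interchanges `e_i` with
the inverse of `e_{n-1-i}`. -/
def iota (n : ℕ) : Graph.Hom (oneSphere n) (oneSphere n) where
  onV (j : ZMod (max n 1)) := (-j : ZMod (max n 1))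
  onE e := (Fin.rev e.1, !e.2)
  src_comm := by
    rintro ⟨i, b⟩
    have hn : max n 1 = n := by have := i.2; omega
    have hz : ((max n 1 : ℕ) : ZMod (max n 1)) = 0 := ZMod.natCast_self _
    have h2 : ((Fin.rev i : ℕ) : ZMod (max n 1)) + (i : ℕ) + 1 = 0 := by
      have h1 : (Fin.rev i : ℕ) + (i : ℕ) + 1 = max n 1 := by
        have := i.2
        rw [Fin.val_rev]; omega
      rw [← hz]
      exact_mod_cast congrArg (fun k : ℕ => (k : ZMod (max n 1))) h1
    cases b
    · simp only [oneSphere, Bool.not_false, if_true, Bool.false_eq_true, if_false]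
      linear_combination h2
    · simp only [oneSphere, Bool.not_true, if_true, Bool.false_eq_true, if_false]
      linear_combination h2
  inv_comm e := by simp [oneSphere]

/-- Orientation preserving isomorphisms of standard 1-spheres (that is, rotations). -/
structure SphereIso (m n : ℕ) where
  onV : (oneSphere m).V ≃ (oneSphere n).V
  onE : (oneSphere m).E ≃ (oneSphere n).E
  src_comm : ∀ e, (oneSphere n).src (onE e) = onV ((oneSphere m).src e)
  inv_comm : ∀ e, onE ((oneSphere m).inv e) = (oneSphere n).inv (onE e)
  orient : ∀ e, (onE e).2 = e.2

namespace SphereIso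

def toHom {m n : ℕ} (φ : SphereIso m n) : Graph.Hom (oneSphere m) (oneSphere n) where
  onV := φ.onV
  onE := φ.onE
  src_comm := φ.src_comm
  inv_comm := φ.inv_comm

def refl (n : ℕ) : SphereIso n n where
  onV := Equiv.refl _
  onE := Equiv.refl _
  src_comm _ := rfl
  inv_comm _ := rfl
  orient _ := rfl

def trans {l m n : ℕ} (φ : SphereIso l m) (ψ : SphereIso m n) : SphereIso l n where
  onV := φ.onV.trans ψ.onV
  onE := φ.onE.trans ψ.onE
  src_comm e := by simp [ψ.src_comm, φ.src_comm]
  inv_comm e := by simp [ψ.inv_comm, φ.inv_comm]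
  orient e := by simp [ψ.orient, φ.orient]

def symm {m n : ℕ} (φ : SphereIso m n) : SphereIso n m where
  onV := φ.onV.symm
  onE := φ.onE.symm
  src_comm e := by
    rw [Equiv.eq_symm_apply, ← φ.src_comm, Equiv.apply_symm_apply]
  inv_comm e := by
    rw [Equiv.symm_apply_eq, φ.inv_comm, Equiv.apply_symm_apply]
  orient e := by
    rw [← φ.orient, Equiv.apply_symm_apply]

/-- An orientation preserving isomorphism of 1-spheres is determined by its vertex map. -/
theorem ext_onV {m n : ℕ} {φ ψ : SphereIso m n} (h : ∀ j, φ.onV j = ψ.onV j) : φ = ψ := by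
  have hV : φ.onV = ψ.onV := Equiv.ext h
  have inj : ∀ i j : Fin n, ((i : ℕ) : ZMod (max n 1)) = ((j : ℕ) : ZMod (max n 1)) → i = j := by
    intro i j hij
    rw [ZMod.natCast_eq_natCast_iff'] at hij
    have hi := i.2
    have hj := j.2
    rw [Nat.mod_eq_of_lt (by omega), Nat.mod_eq_of_lt (by omega)] at hij
    exact Fin.ext hij
  have pos : ∀ i : Fin m, φ.onE (i, true) = ψ.onE (i, true) := by
    intro i
    have h1 := φ.src_comm (i, true)
    have h2 := ψ.src_comm (i, true)
    rw [hV, ← h2] at h1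
    have o1 : (φ.onE (i, true)).2 = true := φ.orient (i, true)
    have o2 : (ψ.onE (i, true)).2 = true := ψ.orient (i, true)
    have h3 : ∀ e : (oneSphere n).E, e.2 = true →
        (oneSphere n).src e = ((e.1 : ℕ) : ZMod (max n 1)) := fun e he => if_pos he
    exact Prod.ext (inj _ _ ((h3 _ o1).symm.trans (h1.trans (h3 _ o2)))) (o1.trans o2.symm)
  have hE : φ.onE = ψ.onE := by
    refine Equiv.ext ?_
    rintro ⟨i, b⟩
    cases b
    · have h1 := φ.inv_comm (i, true)
      have h2 := ψ.inv_comm (i, true)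
      rw [pos i, ← h2] at h1
      exact h1
    · exact pos i
  cases φ; cases ψ; cases hV; cases hE; rfl

end SphereIso

/-! ### 2-complexes -/

/-- Boundary data in a graph: a standard 1-sphere with a dimension preserving attaching map. -/
structure Boundary (G : Graph.{u}) where
  len : ℕ
  att : Graph.Hom (oneSphere len) G

/-- `(S, α) ↦ (S, α ι)`. -/
def Boundary.reverse {G : Graph.{u}} (B : Boundary G) : Boundary G where
  len := B.len
  att := (iota B.len).comp B.att

/-- A combinatorial 2-complex: a graph (its 1-skeleton), and oriented faces `F` with a
fixed-point-free involution, each face `σ` having boundary `bdry σ`. -/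
structure TwoComplex extends Graph.{u} where
  F : Type u
  finv : F → F
  finv_finv : ∀ σ, finv (finv σ) = σ
  finv_ne : ∀ σ, finv σ ≠ σ
  bdry : F → Boundary toGraph
  bdry_finv : ∀ σ, bdry (finv σ) = (bdry σ).reverse

namespace TwoComplex

/-- The corners of a 2-complex: pairs `⟨σ, y⟩` of a face `σ` and a vertex `y` of its boundary
sphere. -/
abbrev Corner (X : TwoComplex.{u}) : Type u := Σ σ : X.F, (oneSphere (X.bdry σ).len).V

/-- The vertex of the complex at a corner; a corner `⟨σ, y⟩` with vertex `x` is an appearance of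
`x` in the boundary of `σ`. -/
def vert (X : TwoComplex.{u}) (c : X.Corner) : X.V := (X.bdry c.1).att.onV c.2

/-- The corner of `σ⁻¹` corresponding to a corner of `σ` under `ι`.  The spheres of `σ` and `σ⁻¹`
have the same length, so that the cast changes nothing. -/
def cornerInv (X : TwoComplex.{u}) (c : X.Corner) : X.Corner :=
  ⟨X.finv c.1, cast (by rw [X.bdry_finv]; rfl) ((iota (X.bdry c.1).len).onV c.2)⟩

/-- Dimension preserving maps of 2-complexes: a dimension preserving map of 1-skeletons, a map of
faces, and for every face `σ` an orientation preserving isomorphism `eps σ` from the boundary sphere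
of `σ` onto that of its image, compatible with the attaching maps and with inversion. -/
structure Hom (X Y : TwoComplex.{u}) extends Graph.Hom X.toGraph Y.toGraph where
  onF : X.F → Y.F
  eps : ∀ σ, SphereIso (X.bdry σ).len (Y.bdry (onF σ)).len
  att_comm : ∀ σ, (X.bdry σ).att.comp toHom = (eps σ).toHom.comp (Y.bdry (onF σ)).att
  onF_inv : ∀ σ, onF (X.finv σ) = Y.finv (onF σ)
  eps_inv : ∀ c : X.Corner,
    (⟨onF (X.cornerInv c).1, (eps (X.cornerInv c).1).onV (X.cornerInv c).2⟩ : Y.Corner) =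
      Y.cornerInv ⟨onF c.1, (eps c.1).onV c.2⟩

namespace Hom

variable {X Y Z : TwoComplex.{u}}

/-- The induced map on corners, `⟨σ, y⟩ ↦ ⟨f σ, ε(f, σ) y⟩`. -/
def onCorner (f : Hom X Y) (c : X.Corner) : Y.Corner := ⟨f.onF c.1, (f.eps c.1).onV c.2⟩

theorem onCorner_inv (f : Hom X Y) (c : X.Corner) :
    f.onCorner (X.cornerInv c) = Y.cornerInv (f.onCorner c) := f.eps_inv c

theorem vert_onCorner (f : Hom X Y) (c : X.Corner) : Y.vert (f.onCorner c) = f.onV (X.vert c) :=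
  (congrFun (congrArg Graph.Hom.onV (f.att_comm c.1)) c.2).symm

/-- Maps agreeing on vertices, edges and corners are equal. -/
theorem ext_corner {f g : Hom X Y} (hV : ∀ x, f.onV x = g.onV x) (hE : ∀ e, f.onE e = g.onE e)
    (hC : ∀ c, f.onCorner c = g.onCorner c) : f = g := by
  have h1 : f.toHom = g.toHom := Graph.Hom.ext (funext hV) (funext hE)
  have h2 : f.onF = g.onF := by
    funext σ
    exact congrArg Sigma.fst (hC ⟨σ, (0 : ZMod _)⟩)
  obtain ⟨f0, fF, fe, fa, fi, fei⟩ := f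
  obtain ⟨g0, gF, ge, ga, gi, gei⟩ := g
  simp only at h1 h2
  subst h1 h2
  have h3 : fe = ge := by
    funext σ
    refine SphereIso.ext_onV fun j => ?_
    exact eq_of_heq (Sigma.mk.inj (hC ⟨σ, j⟩)).2
  subst h3
  rfl

/-- The identity map. -/
def id (X : TwoComplex.{u}) : Hom X X where
  onV := _root_.id
  onE := _root_.id
  src_comm _ := rfl
  inv_comm _ := rfl
  onF := _root_.id
  eps _ := SphereIso.refl _
  att_comm _ := rfl
  onF_inv _ := rfl
  eps_inv _ := rfl

/-- Composition, in diagrammatic order; `ε(gf, σ) = ε(g, f σ) ε(f, σ)`. -/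
def comp (f : Hom X Y) (g : Hom Y Z) : Hom X Z where
  toHom := f.toHom.comp g.toHom
  onF σ := g.onF (f.onF σ)
  eps σ := (f.eps σ).trans (g.eps (f.onF σ))
  att_comm σ := by
    have h1 := congrArg (fun k => k.comp g.toHom) (f.att_comm σ)
    have h2 := congrArg (fun k => (f.eps σ).toHom.comp k) (g.att_comm (f.onF σ))
    exact h1.trans h2
  onF_inv σ := by rw [f.onF_inv, g.onF_inv]
  eps_inv c := (congrArg g.onCorner (f.onCorner_inv c)).trans (g.onCorner_inv (f.onCorner c))

end Hom

/-- The category of 2-complexes and dimension preserving maps.  Two maps are equal when they agree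
on all cells and have the same sphere maps `eps`; the isomorphisms are the maps that are bijective
on vertices, edges and faces. -/
instance : Category.{u} TwoComplex.{u} where
  Hom := Hom
  id := Hom.id
  comp := Hom.comp
  id_comp _ := rfl
  comp_id _ := rfl
  assoc _ _ _ := rfl

end TwoComplex

open TwoComplex

/-! ### Coverings -/

/-- A covering: a dimension preserving map that restricts, for every vertex `x`, to a bijection
from the edges starting at `x` to the edges starting at `f x`, and (for all faces of `X` at once) to
a bijection from the appearances of `x` in boundaries of faces of `Y` to the appearances of `f x` in
boundaries of faces of `X`. -/
structure IsCovering {Y X : TwoComplex.{u}} (f : Y ⟶ X) : Prop where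
  edges : ∀ x : Y.V, Set.BijOn f.onE {e | Y.src e = x} {e | X.src e = f.onV x}
  corners : ∀ x : Y.V, Set.BijOn f.onCorner {c | Y.vert c = x} {c | X.vert c = f.onV x}

/-- The covering has degree `κ`: each fibre, over a vertex, an edge or a face, has cardinality
`κ`. -/
def HasDegree {Y X : TwoComplex.{u}} (f : Y ⟶ X) (κ : Cardinal.{u}) : Prop :=
  (∀ x : X.V, Cardinal.mk {y : Y.V // f.onV y = x} = κ) ∧
  (∀ e : X.E, Cardinal.mk {d : Y.E // f.onE d = e} = κ) ∧
  (∀ τ : X.F, Cardinal.mk {σ : Y.F // f.onF σ = τ} = κ)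

/-- The Galois group of `f : Y ⟶ X`: the automorphisms `a` of `Y` with `f a = f`. -/
def Gal {Y X : TwoComplex.{u}} (f : Y ⟶ X) : Subgroup (Aut Y) where
  carrier := {a | a.hom ≫ f = f}
  mul_mem' {a b} ha hb := by
    change (b.hom ≫ a.hom) ≫ f = f
    have ha' : a.hom ≫ f = f := ha
    have hb' : b.hom ≫ f = f := hb
    rw [Category.assoc, ha', hb']
  one_mem' := Category.id_comp f
  inv_mem' {a} ha := by
    have ha' : a.hom ≫ f = f := ha
    exact (Iso.inv_comp_eq (α := (a : Y ≅ Y))).mpr ha'.symm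

/-- The covering `f` is Galois via the vertex `x` of the base: its Galois group acts regularly
on the fibre of `x`. -/
def IsGaloisVia {Y X : TwoComplex.{u}} (f : Y ⟶ X) (x : X.V) : Prop :=
  ∀ y₁ y₂ : Y.V, f.onV y₁ = x → f.onV y₂ = x → ∃! a : Gal f, a.1.hom.onV y₁ = y₂

theorem IsCovering.id (X : TwoComplex.{u}) : IsCovering (𝟙 X) where
  edges _ := Set.bijOn_id _
  corners _ := Set.bijOn_id _

theorem IsCovering.comp {Z Y X : TwoComplex.{u}} {f : Z ⟶ Y} {g : Y ⟶ X} (hf : IsCovering f)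
    (hg : IsCovering g) : IsCovering (f ≫ g) where
  edges x := (hg.edges (f.onV x)).comp (hf.edges x)
  corners x := (hg.corners (f.onV x)).comp (hf.corners x)

theorem bijOn_of_inverse {α β : Type*} {s : Set α} {t : Set β} {f : α → β} {g : β → α}
    (h1 : Set.MapsTo f s t) (h2 : Set.MapsTo g t s) (h3 : ∀ x, g (f x) = x)
    (h4 : ∀ x, f (g x) = x) : Set.BijOn f s t :=
  ⟨h1, fun a _ b _ hab => by rw [← h3 a, hab, h3], fun b hb => ⟨g b, h2 hb, h4 b⟩⟩

theorem IsCovering.of_iso {Y X : TwoComplex.{u}} (φ : Y ≅ X) : IsCovering φ.hom := by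
  have hi : φ.hom ≫ φ.inv = 𝟙 Y := φ.hom_inv_id
  have hj : φ.inv ≫ φ.hom = 𝟙 X := φ.inv_hom_id
  have hV : ∀ x, φ.inv.onV (φ.hom.onV x) = x := fun x =>
    congrArg (fun k : Y ⟶ Y => Graph.Hom.onV k.toHom x) hi
  have hV' : ∀ x, φ.hom.onV (φ.inv.onV x) = x := fun x =>
    congrArg (fun k : X ⟶ X => Graph.Hom.onV k.toHom x) hj
  have hE : ∀ x, φ.inv.onE (φ.hom.onE x) = x := fun x =>
    congrArg (fun k : Y ⟶ Y => Graph.Hom.onE k.toHom x) hi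
  have hE' : ∀ x, φ.hom.onE (φ.inv.onE x) = x := fun x =>
    congrArg (fun k : X ⟶ X => Graph.Hom.onE k.toHom x) hj
  have hC : ∀ x, φ.inv.onCorner (φ.hom.onCorner x) = x := fun x =>
    congrArg (fun k : Y ⟶ Y => Hom.onCorner k x) hi
  have hC' : ∀ x, φ.hom.onCorner (φ.inv.onCorner x) = x := fun x =>
    congrArg (fun k : X ⟶ X => Hom.onCorner k x) hj
  refine ⟨fun x => bijOn_of_inverse (g := φ.inv.onE) ?_ ?_ hE hE',
    fun x => bijOn_of_inverse (g := φ.inv.onCorner) ?_ ?_ hC hC'⟩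
  · intro e he
    simp only [Set.mem_ofPred_eq] at he ⊢
    rw [φ.hom.src_comm, he]
  · intro e he
    simp only [Set.mem_ofPred_eq] at he ⊢
    rw [φ.inv.src_comm, he, hV]
  · intro c hc
    simp only [Set.mem_ofPred_eq] at hc ⊢
    rw [φ.hom.vert_onCorner, hc]
  · intro c hc
    simp only [Set.mem_ofPred_eq] at hc ⊢
    rw [φ.inv.vert_onCorner, hc, hV]

/-- Coverings of connected complexes are surjective on vertices. -/
theorem IsCovering.surjective_onV {Y X : TwoComplex.{u}} {f : Y ⟶ X} (hf : IsCovering f)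
    (hX : X.Connected) : Function.Surjective f.onV := by
  intro x
  obtain ⟨y⟩ := Y.nonempty_V
  induction hX (f.onV y) x with
  | refl => exact ⟨y, rfl⟩
  | tail _ h ih =>
    obtain ⟨z, rfl⟩ := ih
    obtain ⟨e, he, rfl⟩ := h
    obtain ⟨d, -, rfl⟩ := (hf.edges z).surjOn he
    exact ⟨Y.tgt d, by rw [Graph.tgt, Graph.tgt, ← f.inv_comm, f.src_comm]⟩

/-- Coverings of connected complexes are epimorphisms. -/
theorem IsCovering.cancel {Y Z W : TwoComplex.{u}} {g : Y ⟶ Z} (hg : IsCovering g)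
    (hZ : Z.Connected) {s t : Z ⟶ W} (h : g ≫ s = g ≫ t) : s = t := by
  refine Hom.ext_corner (fun x => ?_) (fun e => ?_) (fun c => ?_)
  · obtain ⟨y, rfl⟩ := hg.surjective_onV hZ x
    exact congrArg (fun k : Y ⟶ W => Graph.Hom.onV k.toHom y) h
  · obtain ⟨y, hy⟩ := hg.surjective_onV hZ (Z.src e)
    obtain ⟨d, -, rfl⟩ := (hg.edges y).surjOn (show Z.src e = g.onV y from hy.symm)
    exact congrArg (fun k : Y ⟶ W => Graph.Hom.onE k.toHom d) h
  · obtain ⟨y, hy⟩ := hg.surjective_onV hZ (Z.vert c)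
    obtain ⟨d, -, rfl⟩ := (hg.corners y).surjOn (show Z.vert c = g.onV y from hy.symm)
    exact congrArg (fun k : Y ⟶ W => Hom.onCorner k d) h

/-! ### The poset of intermediate coverings -/

/-- A pointed connected covering `Y_y → Z_z → X_x` intermediate to `f : Y_y → X_x`. -/
structure IntermediateCover {Y X : TwoComplex.{u}} (f : Y ⟶ X) (y : Y.V) (x : X.V) where
  Z : TwoComplex.{u}
  pt : Z.V
  connected : Z.Connected
  g : Y ⟶ Z
  h : Z ⟶ X
  g_covering : IsCovering g
  h_covering : IsCovering h
  comp_eq : g ≫ h = f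
  g_pt : g.onV y = pt
  h_pt : h.onV pt = x

namespace IntermediateCover

variable {Y X : TwoComplex.{u}} {f : Y ⟶ X} {y : Y.V} {x : X.V}

/-- Equivalence: a pointed isomorphism `Z₁ ≅ Z₂` commuting with the coverings from `Y` and
to `X`. -/
def Equivalent (A B : IntermediateCover f y x) : Prop :=
  ∃ φ : A.Z ≅ B.Z, φ.hom.onV A.pt = B.pt ∧ A.g ≫ φ.hom = B.g ∧ φ.hom ≫ B.h = A.h

/-- `A ≤ B`: there is a pointed covering `Z_B → Z_A` commuting with the coverings from `Y` and
to `X`. -/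
def CoveredBy (A B : IntermediateCover f y x) : Prop :=
  ∃ p : B.Z ⟶ A.Z, IsCovering p ∧ p.onV B.pt = A.pt ∧ B.g ≫ p = A.g ∧ p ≫ A.h = B.h

theorem CoveredBy.trans {A B C : IntermediateCover f y x} (h1 : A.CoveredBy B)
    (h2 : B.CoveredBy C) : A.CoveredBy C := by
  obtain ⟨p, hp, hpt, hg, hh⟩ := h1
  obtain ⟨q, hq, hqt, hg', hh'⟩ := h2
  refine ⟨q ≫ p, hq.comp hp, ?_, ?_, ?_⟩
  · exact (congrArg p.onV hqt).trans hpt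
  · rw [← Category.assoc, hg', hg]
  · rw [Category.assoc, hh, hh']

theorem Equivalent.symm {A B : IntermediateCover f y x} (h : A.Equivalent B) :
    B.Equivalent A := by
  obtain ⟨φ, hpt, hg, hh⟩ := h
  refine ⟨φ.symm, ?_, ?_, ?_⟩
  · rw [← hpt]
    exact congrArg (fun k : A.Z ⟶ A.Z => Graph.Hom.onV k.toHom A.pt) φ.hom_inv_id
  · rw [← hg, Iso.symm_hom, Category.assoc, Iso.hom_inv_id, Category.comp_id]
  · rw [← hh, Iso.symm_hom, ← Category.assoc, Iso.inv_hom_id, Category.id_comp]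

theorem Equivalent.coveredBy {A B : IntermediateCover f y x} (h : A.Equivalent B) :
    B.CoveredBy A := by
  obtain ⟨φ, hpt, hg, hh⟩ := h
  exact ⟨φ.hom, IsCovering.of_iso φ, hpt, hg, hh⟩

theorem equivalent_of_coveredBy {A B : IntermediateCover f y x} (h1 : A.CoveredBy B)
    (h2 : B.CoveredBy A) : A.Equivalent B := by
  obtain ⟨p, hp, hpt, hg, hh⟩ := h1
  obtain ⟨q, hq, hqt, hg', hh'⟩ := h2
  refine ⟨⟨q, p, ?_, ?_⟩, hqt, hg', hh'⟩
  · refine A.g_covering.cancel A.connected ?_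
    rw [← Category.assoc, hg', hg, Category.comp_id]
  · refine B.g_covering.cancel B.connected ?_
    rw [← Category.assoc, hg, hg', Category.comp_id]

/-- Equivalence of intermediate coverings as a setoid. -/
instance setoid (f : Y ⟶ X) (y : Y.V) (x : X.V) : Setoid (IntermediateCover f y x) where
  r := Equivalent
  iseqv :=
    { refl := fun _ => ⟨Iso.refl _, rfl, Category.comp_id _, Category.id_comp _⟩
      symm := Equivalent.symm
      trans := fun h1 h2 => equivalent_of_coveredBy
        (h1.symm.coveredBy.trans h2.symm.coveredBy) (h2.coveredBy.trans h1.coveredBy) }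

/-- `Gal(Y, Z)` as a subgroup of `Gal(Y, X)`. -/
def gal (A : IntermediateCover f y x) : Subgroup (Gal f) := (Gal A.g).subgroupOf (Gal f)

end IntermediateCover

/-- Equivalence classes of pointed connected coverings intermediate to `f : Y_y → X_x`. -/
def IntermediateCovers {Y X : TwoComplex.{u}} (f : Y ⟶ X) (y : Y.V) (x : X.V) : Type (u + 1) :=
  Quotient (IntermediateCover.setoid f y x)

/-- The class of an intermediate covering. -/
def IntermediateCover.cls {Y X : TwoComplex.{u}} {f : Y ⟶ X} {y : Y.V} {x : X.V}
    (A : IntermediateCover f y x) : IntermediateCovers f y x :=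
  Quotient.mk (IntermediateCover.setoid f y x) A

/-- The order on classes of intermediate coverings: `[Z₁] ≤ [Z₂]` iff `Z₂` covers `Z₁`. -/
instance {Y X : TwoComplex.{u}} (f : Y ⟶ X) (y : Y.V) (x : X.V) :
    PartialOrder (IntermediateCovers f y x) where
  le := Quotient.lift₂ IntermediateCover.CoveredBy fun _ _ _ _ h1 h2 => propext
    ⟨fun h => (h1.coveredBy.trans h).trans h2.symm.coveredBy,
      fun h => (h1.symm.coveredBy.trans h).trans h2.coveredBy⟩
  le_refl := by
    rintro ⟨_⟩
    exact ⟨𝟙 _, IsCovering.id _, rfl, Category.comp_id _, Category.id_comp _⟩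
  le_trans := by
    rintro ⟨_⟩ ⟨_⟩ ⟨_⟩ h1 h2
    exact IntermediateCover.CoveredBy.trans h1 h2
  le_antisymm := by
    rintro ⟨_⟩ ⟨_⟩ h1 h2
    exact Quotient.sound (IntermediateCover.equivalent_of_coveredBy h1 h2)

/-! ### Quotients by subgroups of the Galois group -/

instance (Y : TwoComplex.{u}) : MulAction (Aut Y) Y.V where
  smul a x := a.hom.onV x
  one_smul _ := rfl
  mul_smul _ _ _ := rfl

instance (Y : TwoComplex.{u}) : MulAction (Aut Y) Y.E where
  smul a e := a.hom.onE e
  one_smul _ := rfl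
  mul_smul _ _ _ := rfl

instance (Y : TwoComplex.{u}) : MulAction (Aut Y) Y.F where
  smul a σ := a.hom.onF σ
  one_smul _ := rfl
  mul_smul _ _ _ := rfl

/-- Composition of the attaching map of boundary data with a graph map. -/
def Boundary.map {G : Graph.{u}} {K : Graph.{v}} (B : Boundary G) (q : Graph.Hom G K) :
    Boundary K where
  len := B.len
  att := B.att.comp q

/-- Relabelling of the sphere of boundary data along an orientation preserving isomorphism. -/
def Boundary.relabel {G : Graph.{u}} (B : Boundary G) {n : ℕ} (φ : SphereIso B.len n) :
    Boundary G where
  len := n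
  att := φ.symm.toHom.comp B.att

theorem iota_onV_iota (n : ℕ) (j : (oneSphere n).V) : (iota n).onV ((iota n).onV j) = j :=
  neg_neg (G := ZMod (max n 1)) j

theorem iota_onE_iota (n : ℕ) (e : (oneSphere n).E) : (iota n).onE ((iota n).onE e) = e :=
  Prod.ext (Fin.rev_rev e.1) (Bool.not_not e.2)

/-- The conjugate of an orientation preserving isomorphism by the reflections. -/
def SphereIso.conj {m n : ℕ} (φ : SphereIso m n) : SphereIso m n where
  onV := ⟨fun j => (iota n).onV (φ.onV ((iota m).onV j)),
    fun j => (iota m).onV (φ.onV.symm ((iota n).onV j)),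
    fun j => by simp [iota_onV_iota], fun j => by simp [iota_onV_iota]⟩
  onE := ⟨fun j => (iota n).onE (φ.onE ((iota m).onE j)),
    fun j => (iota m).onE (φ.onE.symm ((iota n).onE j)),
    fun j => by simp [iota_onE_iota], fun j => by simp [iota_onE_iota]⟩
  src_comm e := by
    change (oneSphere n).src ((iota n).onE (φ.onE ((iota m).onE e))) =
      (iota n).onV (φ.onV ((iota m).onV _))
    rw [(iota n).src_comm, φ.src_comm, (iota m).src_comm]
  inv_comm e := by
    change (iota n).onE (φ.onE ((iota m).onE _)) = (oneSphere n).inv ((iota n).onE _)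
    rw [(iota m).inv_comm, φ.inv_comm, (iota n).inv_comm]
  orient e := by
    change (!(φ.onE ((iota m).onE e)).2) = e.2
    rw [φ.orient]
    simp [iota]

theorem Boundary.relabel_reverse {G : Graph.{u}} {B B' : Boundary G} (hB : B' = B.reverse)
    {n n' : ℕ} (hn : n' = n) (φ : SphereIso B.len n) (φ' : SphereIso B'.len n')
    (hc : (oneSphere B.len).V = (oneSphere B'.len).V) (hc' : (oneSphere n).V = (oneSphere n').V)
    (h : ∀ j, φ'.onV (cast hc ((iota B.len).onV j)) = cast hc' ((iota n).onV (φ.onV j))) :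
    B'.relabel φ' = (B.relabel φ).reverse := by
  subst hB hn
  have : φ' = φ.conj := SphereIso.ext_onV fun j => by
    exact (congrArg φ'.onV (iota_onV_iota B.len j).symm).trans (h ((iota B.len).onV j))
  subst this
  refine congrArg (Boundary.mk n') (Graph.Hom.ext (funext fun j => ?_) (funext fun j => ?_))
  · exact congrArg B.att.onV (iota_onV_iota B.len _)
  · exact congrArg B.att.onE (iota_onE_iota B.len _)

section Quotient

variable {Y X : TwoComplex.{u}} (f : Y ⟶ X) (H : Subgroup (Gal f))

theorem TwoComplex.corner_eq_inv {X : TwoComplex.{u}} {c d : X.Corner} (h : c = X.cornerInv d)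
    (hc : (oneSphere (X.bdry d.1).len).V = (oneSphere (X.bdry c.1).len).V) :
    c.2 = cast hc ((iota (X.bdry d.1).len).onV d.2) := by
  subst h; rfl

theorem Gal_comp_eq {f : Y ⟶ X} (a : Gal f) : a.1.hom ≫ f = f := a.2

theorem Gal_onV_eq {f : Y ⟶ X} (a : Gal f) (x : Y.V) : f.onV (a.1.hom.onV x) = f.onV x :=
  congrArg (fun k : Y ⟶ X => Graph.Hom.onV k.toHom x) (Gal_comp_eq a)

theorem Gal_onE_eq {f : Y ⟶ X} (a : Gal f) (x : Y.E) : f.onE (a.1.hom.onE x) = f.onE x :=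
  congrArg (fun k : Y ⟶ X => Graph.Hom.onE k.toHom x) (Gal_comp_eq a)

theorem Gal_onF_eq {f : Y ⟶ X} (a : Gal f) (x : Y.F) : f.onF (a.1.hom.onF x) = f.onF x :=
  congrArg (fun k : Y ⟶ X => Hom.onF k x) (Gal_comp_eq a)

theorem Gal_onCorner_eq {f : Y ⟶ X} (a : Gal f) (c : Y.Corner) :
    f.onCorner (a.1.hom.onCorner c) = f.onCorner c :=
  congrArg (fun k : Y ⟶ X => Hom.onCorner k c) (Gal_comp_eq a)

/-- The 1-skeleton of `Y / H`: its vertices and edges are the `H`-orbits. -/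
def quotGraph : Graph.{u} where
  V := MulAction.orbitRel.Quotient H Y.V
  E := MulAction.orbitRel.Quotient H Y.E
  nonempty_V := Y.nonempty_V.map (Quotient.mk _)
  src := Quotient.map' Y.src (by
    rintro _ e ⟨a, rfl⟩
    exact ⟨a, (a.1.1.hom.src_comm e).symm⟩)
  inv := Quotient.map' Y.inv (by
    rintro _ e ⟨a, rfl⟩
    exact ⟨a, a.1.1.hom.inv_comm e⟩)
  inv_inv := by
    rintro ⟨e⟩
    exact congrArg (Quotient.mk _) (Y.inv_inv e)
  inv_ne := by
    rintro ⟨e⟩ h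
    obtain ⟨a, ha⟩ := Quotient.exact h
    have h1 : a.1.1.hom.onE e = Y.inv e := ha
    have h2 := Gal_onE_eq a.1 e
    rw [h1, f.inv_comm] at h2
    exact X.inv_ne _ h2

/-- The quotient map on 1-skeletons. -/
def quotGraphMap : Graph.Hom Y.toGraph (quotGraph f H) where
  onV x := Quotient.mk _ x
  onE e := Quotient.mk _ e
  src_comm _ := rfl
  inv_comm _ := rfl

theorem quotGraphMap_comp (a : H) : a.1.1.hom.toHom.comp (quotGraphMap f H) = quotGraphMap f H :=
  Graph.Hom.ext (funext fun _ => Quotient.sound ⟨a, rfl⟩) (funext fun _ => Quotient.sound ⟨a, rfl⟩)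

/-- The boundary of the orbit of `σ`: the attaching map of `σ` followed by the quotient map, with
the sphere of `σ` relabelled along `ε(f, σ)`.  This labelling does not depend on the choice of `σ`
in its orbit. -/
def quotBoundary (σ : Y.F) : Boundary (quotGraph f H) :=
  ((Y.bdry σ).relabel (f.eps σ)).map (quotGraphMap f H)

theorem quotBoundary_smul (a : H) (σ : Y.F) :
    quotBoundary f H (a.1.1.hom.onF σ) = quotBoundary f H σ := by
  have h1 : ∀ g : Y ⟶ X, g = f →
      ((Y.bdry σ).relabel (g.eps σ)).map (quotGraphMap f H) = quotBoundary f H σ := by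
    rintro g rfl; rfl
  rw [← h1 _ (Gal_comp_eq a.1)]
  refine congrArg (Boundary.mk _) ?_
  set A : Y ⟶ Y := a.1.1.hom with hA
  have h2 := congrArg (fun k => (A.eps σ).symm.toHom.comp (k.comp (quotGraphMap f H)))
    (A.att_comm σ)
  have h3 : (A.eps σ).symm.toHom.comp (((A.eps σ).toHom.comp (Y.bdry (A.onF σ)).att).comp
      (quotGraphMap f H)) = (Y.bdry (A.onF σ)).att.comp (quotGraphMap f H) := by
    refine Graph.Hom.ext (funext fun j => ?_) (funext fun j => ?_)
    · exact congrArg (fun k => (quotGraphMap f H).onV ((Y.bdry (A.onF σ)).att.onV k))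
        ((A.eps σ).onV.apply_symm_apply j)
    · exact congrArg (fun k => (quotGraphMap f H).onE ((Y.bdry (A.onF σ)).att.onE k))
        ((A.eps σ).onE.apply_symm_apply j)
  have h4 : A.toHom.comp (quotGraphMap f H) = quotGraphMap f H := quotGraphMap_comp f H a
  have h5 := congrArg (fun k => (A.eps σ).symm.toHom.comp ((Y.bdry σ).att.comp k)) h4
  have h6 := h3.symm.trans (h2.symm.trans h5)
  exact congrArg (fun k => (f.eps (A.onF σ)).symm.toHom.comp k) h6

/-- The quotient complex `Y / H`: its cells are the `H`-orbits of cells of `Y`. -/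
def quot : TwoComplex.{u} where
  toGraph := quotGraph f H
  F := MulAction.orbitRel.Quotient H Y.F
  finv := Quotient.map' Y.finv (by
    rintro _ σ ⟨a, rfl⟩
    exact ⟨a, a.1.1.hom.onF_inv σ⟩)
  finv_finv := by
    rintro ⟨σ⟩
    exact congrArg (Quotient.mk _) (Y.finv_finv σ)
  finv_ne := by
    rintro ⟨σ⟩ h
    obtain ⟨a, ha⟩ := Quotient.exact h
    have h1 : a.1.1.hom.onF σ = Y.finv σ := ha
    have h2 := Gal_onF_eq a.1 σ
    rw [h1, f.onF_inv] at h2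
    exact X.finv_ne _ h2
  bdry := Quotient.lift (quotBoundary f H) (by
    rintro _ σ ⟨a, rfl⟩
    exact quotBoundary_smul f H a σ)
  bdry_finv := by
    rintro ⟨σ⟩
    refine congrArg (fun B => B.map (quotGraphMap f H)) (Boundary.relabel_reverse
      (B := Y.bdry σ) (B' := Y.bdry (Y.finv σ)) (Y.bdry_finv σ) ?_ (f.eps σ) (f.eps (Y.finv σ))
      ?_ ?_ ?_)
    · rw [f.onF_inv, X.bdry_finv]; rfl
    · rw [Y.bdry_finv]; rfl
    · rw [f.onF_inv, X.bdry_finv]; rfl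
    · intro j
      exact TwoComplex.corner_eq_inv (f.eps_inv ⟨σ, j⟩) _

/-- The quotient map `Y ⟶ Y / H`. -/
def quotMap : Y ⟶ quot f H where
  toHom := quotGraphMap f H
  onF σ := Quotient.mk _ σ
  eps σ := f.eps σ
  att_comm σ := by
    refine Graph.Hom.ext (funext fun j => ?_) (funext fun j => ?_)
    · exact congrArg (fun k => (quotGraphMap f H).onV ((Y.bdry σ).att.onV k))
        ((f.eps σ).onV.symm_apply_apply j).symm
    · exact congrArg (fun k => (quotGraphMap f H).onE ((Y.bdry σ).att.onE k))
        ((f.eps σ).onE.symm_apply_apply j).symm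
  onF_inv _ := rfl
  eps_inv c := by
    refine congrArg (Sigma.mk _) ?_
    exact TwoComplex.corner_eq_inv (f.eps_inv c) _

/-- The face map of `Y / H ⟶ X`. -/
def quotDescF : (quot f H).F → X.F :=
  Quotient.lift f.onF (by
    rintro _ x ⟨a, rfl⟩
    exact Gal_onF_eq a.1 x)

theorem quotBoundary_len (c : (quot f H).F) :
    ((quot f H).bdry c).len = (X.bdry (quotDescF f H c)).len := by
  obtain ⟨σ⟩ := c
  rfl

/-- The sphere of an orbit `[σ]` is, by construction, the sphere of the face `f σ` of `X`. -/
def quotDescEps (c : (quot f H).F) :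
    SphereIso ((quot f H).bdry c).len (X.bdry (quotDescF f H c)).len :=
  quotBoundary_len f H c ▸ SphereIso.refl _

/-- The map `Y / H ⟶ X` induced by `f`. -/
def quotDesc : quot f H ⟶ X where
  onV := Quotient.lift f.onV (by
    rintro _ x ⟨a, rfl⟩
    exact Gal_onV_eq a.1 x)
  onE := Quotient.lift f.onE (by
    rintro _ x ⟨a, rfl⟩
    exact Gal_onE_eq a.1 x)
  src_comm := by
    rintro ⟨e⟩
    exact f.src_comm e
  inv_comm := by
    rintro ⟨e⟩
    exact f.inv_comm e
  onF := quotDescF f H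
  eps := quotDescEps f H
  att_comm := by
    rintro ⟨σ⟩
    refine Graph.Hom.ext (funext fun j => ?_) (funext fun j => ?_)
    · refine (congrArg (fun k => k.onV ((f.eps σ).onV.symm j)) (f.att_comm σ)).trans ?_
      exact congrArg (X.bdry (f.onF σ)).att.onV ((f.eps σ).onV.apply_symm_apply j)
    · refine (congrArg (fun k => k.onE ((f.eps σ).onE.symm j)) (f.att_comm σ)).trans ?_
      exact congrArg (X.bdry (f.onF σ)).att.onE ((f.eps σ).onE.apply_symm_apply j)
  onF_inv := by
    rintro ⟨σ⟩
    exact f.onF_inv σ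
  eps_inv := by
    rintro ⟨⟨σ⟩, j⟩
    obtain ⟨i, rfl⟩ := (f.eps σ).onV.surjective j
    exact (congrArg (fun c : (quot f H).Corner =>
      (⟨quotDescF f H c.1, (quotDescEps f H c.1).onV c.2⟩ : X.Corner))
      ((quotMap f H).onCorner_inv ⟨σ, i⟩).symm).trans (f.eps_inv ⟨σ, i⟩)

theorem quotMap_comp_quotDesc : quotMap f H ≫ quotDesc f H = f := by
  refine Hom.ext_corner (fun _ => rfl) (fun _ => rfl) (fun _ => rfl)

variable {f}

theorem quotMap_onV_surjective : Function.Surjective (quotMap f H).onV := Quotient.mk_surjective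

theorem quotMap_onE_surjective : Function.Surjective (quotMap f H).onE := Quotient.mk_surjective

theorem quotMap_onCorner_surjective : Function.Surjective (quotMap f H).onCorner := by
  rintro ⟨⟨σ⟩, j⟩
  obtain ⟨i, rfl⟩ := (f.eps σ).onV.surjective j
  exact ⟨⟨σ, i⟩, rfl⟩

theorem quotDesc_onV (x : Y.V) : (quotDesc f H).onV ((quotMap f H).onV x) = f.onV x := rfl

theorem quotDesc_onE (x : Y.E) : (quotDesc f H).onE ((quotMap f H).onE x) = f.onE x := rfl

theorem quotDesc_onCorner (c : Y.Corner) :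
    (quotDesc f H).onCorner ((quotMap f H).onCorner c) = f.onCorner c := rfl

theorem quotMap_onV_eq {x y : Y.V} (h : (quotMap f H).onV x = (quotMap f H).onV y) :
    ∃ a : H, a.1.1.hom.onV y = x := Quotient.exact h

theorem quotMap_onE_smul (a : H) (e : Y.E) :
    (quotMap f H).onE (a.1.1.hom.onE e) = (quotMap f H).onE e := Quotient.sound ⟨a, rfl⟩

theorem quotMap_onCorner_smul (a : H) (c : Y.Corner) :
    (quotMap f H).onCorner (a.1.1.hom.onCorner c) = (quotMap f H).onCorner c := by
  have h1 : (quotMap f H).onF (a.1.1.hom.onF c.1) = (quotMap f H).onF c.1 := Quotient.sound ⟨a, rfl⟩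
  have h2 := (Sigma.mk.inj (Gal_onCorner_eq a.1 c)).2
  exact Sigma.ext h1 h2

/-- The quotient map by a subgroup of the Galois group of a covering is a covering. -/
theorem quotMap_covering (hf : IsCovering f) : IsCovering (quotMap f H) where
  edges x := by
    refine ⟨fun e he => ?_, fun d hd e he h => ?_, fun e he => ?_⟩
    · exact (congrArg (quotMap f H).onV (show Y.src e = x from he) :)
    · exact (hf.edges x).injOn hd he (congrArg (quotDesc f H).onE h)
    · obtain ⟨d, rfl⟩ := quotMap_onE_surjective H e
      obtain ⟨a, ha⟩ := quotMap_onV_eq H (show (quotMap f H).onV x = (quotMap f H).onV (Y.src d)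
        from (show (quotMap f H).onV (Y.src d) = (quotMap f H).onV x from he).symm)
      exact ⟨a.1.1.hom.onE d, (a.1.1.hom.src_comm d).trans ha, quotMap_onE_smul H a d⟩
  corners x := by
    refine ⟨fun e he => ?_, fun d hd e he h => ?_, fun e he => ?_⟩
    · exact ((quotMap f H).vert_onCorner e).trans
        (congrArg (quotMap f H).onV (show Y.vert e = x from he))
    · exact (hf.corners x).injOn hd he (congrArg (quotDesc f H).onCorner h)
    · obtain ⟨d, rfl⟩ := quotMap_onCorner_surjective H e
      obtain ⟨a, ha⟩ := quotMap_onV_eq H (((quotMap f H).vert_onCorner d).symm.trans he).symm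
      exact ⟨a.1.1.hom.onCorner d, (a.1.1.hom.vert_onCorner d).trans ha,
        quotMap_onCorner_smul H a d⟩

/-- The induced map `Y / H ⟶ X` is a covering. -/
theorem quotDesc_covering (hf : IsCovering f) : IsCovering (quotDesc f H) where
  edges x := by
    obtain ⟨y, rfl⟩ := quotMap_onV_surjective H x
    have hq := (quotMap_covering H hf).edges y
    have hy := hf.edges y
    refine ⟨fun e he => ?_, fun d hd e he h => ?_, fun e he => ?_⟩
    · exact ((quotDesc f H).src_comm e).trans (congrArg (quotDesc f H).onV he)
    · obtain ⟨d, hd', rfl⟩ := hq.surjOn hd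
      obtain ⟨e, he', rfl⟩ := hq.surjOn he
      exact congrArg (quotMap f H).onE (hy.injOn hd' he' h)
    · obtain ⟨d, hd, rfl⟩ := hy.surjOn he
      exact ⟨(quotMap f H).onE d, hq.mapsTo hd, rfl⟩
  corners x := by
    obtain ⟨y, rfl⟩ := quotMap_onV_surjective H x
    have hq := (quotMap_covering H hf).corners y
    have hy := hf.corners y
    refine ⟨fun e he => ?_, fun d hd e he h => ?_, fun e he => ?_⟩
    · exact ((quotDesc f H).vert_onCorner e).trans (congrArg (quotDesc f H).onV he)
    · obtain ⟨d, hd', rfl⟩ := hq.surjOn hd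
      obtain ⟨e, he', rfl⟩ := hq.surjOn he
      exact congrArg (quotMap f H).onCorner (hy.injOn hd' he' h)
    · obtain ⟨d, hd, rfl⟩ := hy.surjOn he
      exact ⟨(quotMap f H).onCorner d, hq.mapsTo hd, rfl⟩

theorem quot_connected (hY : Y.Connected) : (quot f H).Connected := by
  intro x y
  obtain ⟨x, rfl⟩ := quotMap_onV_surjective H x
  obtain ⟨y, rfl⟩ := quotMap_onV_surjective H y
  induction hY x y with
  | refl => exact .refl
  | tail _ h ih =>
    obtain ⟨e, rfl, rfl⟩ := h
    exact ih.tail ⟨(quotMap f H).onE e, rfl, rfl⟩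

/-- The pointed intermediate covering `Y_y → (Y / H)_{q(y)} → X_x`. -/
def quotCover (hf : IsCovering f) (hY : Y.Connected) {y : Y.V} {x : X.V} (hyx : f.onV y = x) :
    IntermediateCover f y x where
  Z := quot f H
  pt := (quotMap f H).onV y
  connected := quot_connected H hY
  g := quotMap f H
  h := quotDesc f H
  g_covering := quotMap_covering H hf
  h_covering := quotDesc_covering H hf
  comp_eq := quotMap_comp_quotDesc f H
  g_pt := rfl
  h_pt := hyx

end Quotient

end CombTop

open CombTop

namespace CombTop

open TwoComplex

variable {W Y Z X : TwoComplex.{u}}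

/-! Two properties of coverings of connected complexes carry the proof. Rigidity
(`IsCovering.lift_unique`): lifts of one map that agree at a vertex coincide, so a deck
transformation is determined by the image of one vertex. Descent
(`IsCovering.exists_descent_of_gal`): if `Gal g` is transitive on the vertex fibres of `g`, then `g`
is the categorical quotient of `Y` by `Gal g`.

Transitivity over one vertex of `X` spreads along edges to all fibres
(`IsCovering.fibreTransitive`). It passes to `Y → Z`: a deck transformation `a` over `X` matching
two points with the same image in `Z` makes `a.hom ≫ g` and `g` two lifts of `f` that agree at a
vertex, so `a` lies in `Gal(Y, Z)`. Hence every `Y → Z` is a quotient map, and a covering `Z' → Z`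
under `Y` exists iff `Gal(Y, Z') ≤ Gal(Y, Z)` (`coveredBy_iff`). Every subgroup `H` occurs, because
an element of `Gal(Y, Y/H)` agrees at the base point with an element of `H` (`gal_quotCover`). This
is the anti-isomorphism, and the lattice structure is transported from the subgroups.

Normality of `Gal(Y, Z)` means that all deck transformations of `Y` descend to `Z`, and the degree
is an orbit-stabilizer count on a vertex fibre. -/

theorem TwoComplex.comp_onV (f : Y ⟶ Z) (g : Z ⟶ X) (y : Y.V) :
    (f ≫ g).onV y = g.onV (f.onV y) := rfl

/-! ### Lifting and descent along coverings -/

theorem TwoComplex.Hom.tgt_comm (f : Y ⟶ X) (e : Y.E) : X.tgt (f.onE e) = f.onV (Y.tgt e) := by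
  rw [Graph.tgt, Graph.tgt, ← f.inv_comm, f.src_comm]

/-- Because `eps σ` is a bijection of spheres, a face over `c.1` has exactly one corner over `c`.
This lemma and the next are the two halves; they reduce questions about faces to corners, where the
covering condition applies. -/
theorem TwoComplex.Hom.exists_corner_of_onF (f : Y ⟶ X) {σ : Y.F} (c : X.Corner)
    (h : f.onF σ = c.1) : ∃ j, f.onCorner ⟨σ, j⟩ = c := by
  obtain ⟨τ, i⟩ := c
  obtain rfl : f.onF σ = τ := h
  obtain ⟨j, rfl⟩ := (f.eps σ).onV.surjective i
  exact ⟨j, rfl⟩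

theorem TwoComplex.Hom.onCorner_injective_on_face (f : Y ⟶ X) {c d : Y.Corner} (h : c.1 = d.1)
    (hf : f.onCorner c = f.onCorner d) : c = d := by
  obtain ⟨σ, i⟩ := c
  obtain ⟨τ, j⟩ := d
  obtain rfl : σ = τ := h
  have : i = j := (f.eps σ).onV.injective (eq_of_heq (Sigma.mk.inj hf).2)
  rw [this]

theorem IsCovering.onE_injective_of_src {f : Y ⟶ X} (hf : IsCovering f) {d e : Y.E}
    (hs : Y.src d = Y.src e) (h : f.onE d = f.onE e) : d = e :=
  (hf.edges (Y.src e)).injOn hs rfl h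

theorem IsCovering.onCorner_injective_of_vert {f : Y ⟶ X} (hf : IsCovering f) {c d : Y.Corner}
    (hs : Y.vert c = Y.vert d) (h : f.onCorner c = f.onCorner d) : c = d :=
  (hf.corners (Y.vert d)).injOn hs rfl h

theorem IsCovering.exists_lift_edge {f : Y ⟶ X} (hf : IsCovering f) {y : Y.V} {e : X.E}
    (h : X.src e = f.onV y) : ∃ d, Y.src d = y ∧ f.onE d = e :=
  (hf.edges y).surjOn h

theorem IsCovering.exists_lift_corner {f : Y ⟶ X} (hf : IsCovering f) {y : Y.V} {c : X.Corner}
    (h : X.vert c = f.onV y) : ∃ d, Y.vert d = y ∧ f.onCorner d = c :=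
  (hf.corners y).surjOn h

theorem IsCovering.surjective_onE {f : Y ⟶ X} (hf : IsCovering f) (hX : X.Connected) :
    Function.Surjective f.onE := by
  intro e
  obtain ⟨y, hy⟩ := hf.surjective_onV hX (X.src e)
  obtain ⟨d, -, hd⟩ := hf.exists_lift_edge hy.symm
  exact ⟨d, hd⟩

theorem IsCovering.surjective_onCorner {f : Y ⟶ X} (hf : IsCovering f) (hX : X.Connected) :
    Function.Surjective f.onCorner := by
  intro c
  obtain ⟨y, hy⟩ := hf.surjective_onV hX (X.vert c)
  obtain ⟨d, -, hd⟩ := hf.exists_lift_corner hy.symm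
  exact ⟨d, hd⟩

theorem IsCovering.surjective_onF {f : Y ⟶ X} (hf : IsCovering f) (hX : X.Connected) :
    Function.Surjective f.onF := by
  intro σ
  -- Every boundary sphere has the vertex `0`, also when its length is `0`, so every face has a
  -- corner.
  obtain ⟨d, hd⟩ := hf.surjective_onCorner hX ⟨σ, (0 : ZMod _)⟩
  exact ⟨d.1, congrArg Sigma.fst hd⟩

/-- Lifts through a covering which agree at one vertex of a connected complex are equal. -/
theorem IsCovering.lift_unique {p : Z ⟶ X} (hp : IsCovering p) (hW : W.Connected) {s t : W ⟶ Z}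
    (h : s ≫ p = t ≫ p) {w : W.V} (hw : s.onV w = t.onV w) : s = t := by
  have hE : ∀ e, p.onE (s.onE e) = p.onE (t.onE e) := fun e =>
    congrArg (fun k : W ⟶ X => k.onE e) h
  -- Agreement at the start of an edge forces agreement on the edge, hence at its end; it therefore
  -- spreads over the connected complex.
  have edge : ∀ e, s.onV (W.src e) = t.onV (W.src e) → s.onE e = t.onE e := fun e he =>
    hp.onE_injective_of_src (by rw [s.src_comm, t.src_comm, he]) (hE e)
  have hV : ∀ x, s.onV x = t.onV x := by
    intro x
    induction hW w x with
    | refl => exact hw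
    | tail _ h ih =>
      obtain ⟨e, rfl, rfl⟩ := h
      rw [← s.tgt_comm, ← t.tgt_comm, edge e ih]
  refine Hom.ext_corner hV (fun e => edge e (hV _)) fun c => ?_
  exact hp.onCorner_injective_of_vert (by rw [s.vert_onCorner, t.vert_onCorner, hV])
    (congrArg (fun k : W ⟶ X => k.onCorner c) h)

/-- A map through which a covering factors after a covering of a connected complex is a
covering. -/
theorem IsCovering.of_comp {g : Y ⟶ Z} {p : Z ⟶ X} (hg : IsCovering g) (hZ : Z.Connected)
    (h : IsCovering (g ≫ p)) : IsCovering p where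
  edges x := by
    obtain ⟨y, rfl⟩ := hg.surjective_onV hZ x
    refine ⟨fun e he => (p.src_comm e).trans (congrArg p.onV he), fun d hd e he hde => ?_,
      fun e he => ?_⟩
    -- Both edges are lifted to the same vertex `y`, where the composite is injective; corners are
    -- treated alike.
    · obtain ⟨d, hd', rfl⟩ := hg.exists_lift_edge hd
      obtain ⟨e, he', rfl⟩ := hg.exists_lift_edge he
      exact congrArg g.onE (h.onE_injective_of_src (hd'.trans he'.symm) hde)
    · obtain ⟨d, rfl, rfl⟩ := h.exists_lift_edge (y := y) he
      exact ⟨g.onE d, g.src_comm d, rfl⟩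
  corners x := by
    obtain ⟨y, rfl⟩ := hg.surjective_onV hZ x
    refine ⟨fun e he => (p.vert_onCorner e).trans (congrArg p.onV he), fun d hd e he hde => ?_,
      fun e he => ?_⟩
    · obtain ⟨d, hd', rfl⟩ := hg.exists_lift_corner hd
      obtain ⟨e, he', rfl⟩ := hg.exists_lift_corner he
      exact congrArg g.onCorner (h.onCorner_injective_of_vert (hd'.trans he'.symm) hde)
    · obtain ⟨d, rfl, rfl⟩ := h.exists_lift_corner (y := y) he
      exact ⟨g.onCorner d, g.vert_onCorner d, rfl⟩

/-- A map of complexes from a map of 1-skeletons and compatible maps of faces and corners. -/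
theorem TwoComplex.exists_hom_of_onCorner (p : Graph.Hom Z.toGraph X.toGraph) (pF : Z.F → X.F)
    (C : Z.Corner → X.Corner)
    (hε : ∀ σ, ∃ ε : SphereIso (Z.bdry σ).len (X.bdry (pF σ)).len,
      (∀ j, (⟨pF σ, ε.onV j⟩ : X.Corner) = C ⟨σ, j⟩) ∧
        (Z.bdry σ).att.comp p = ε.toHom.comp (X.bdry (pF σ)).att)
    (hF : ∀ σ, pF (Z.finv σ) = X.finv (pF σ))
    (hC : ∀ c, C (Z.cornerInv c) = X.cornerInv (C c)) :
    ∃ k : Z ⟶ X, k.toHom = p ∧ ∀ c, k.onCorner c = C c := by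
  choose ε h1 h2 using hε
  refine ⟨{ toHom := p, onF := pF, eps := ε, att_comm := h2, onF_inv := hF, eps_inv := ?_ },
    rfl, fun c => h1 c.1 c.2⟩
  intro c
  -- `h1` trades the dependent sphere maps for the plain function `C`, so that compatibility with
  -- inversion is an equation between corners.
  rw [h1, h1]
  exact hC c

/-- Descent of a map along a covering of a connected complex. -/
theorem IsCovering.exists_descent {g : Y ⟶ Z} (hg : IsCovering g) (hZ : Z.Connected) (k : Y ⟶ X)
    (hV : ∀ a b, g.onV a = g.onV b → k.onV a = k.onV b)
    (hE : ∀ a b, g.onE a = g.onE b → k.onE a = k.onE b)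
    (hC : ∀ a b, g.onCorner a = g.onCorner b → k.onCorner a = k.onCorner b) :
    ∃ p : Z ⟶ X, g ≫ p = k := by
  -- Faces need no hypothesis of their own: some corner of `a` has the same image as the corner `0`
  -- of `b`.
  have hF : ∀ a b, g.onF a = g.onF b → k.onF a = k.onF b := by
    intro a b h
    obtain ⟨j, hj⟩ := g.exists_corner_of_onF (σ := a) (g.onCorner ⟨b, (0 : ZMod _)⟩) h
    exact congrArg Sigma.fst (hC _ _ hj)
  have sV := hg.surjective_onV hZ
  have sE := hg.surjective_onE hZ
  have sF := hg.surjective_onF hZ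
  have sC := hg.surjective_onCorner hZ
  -- Each map takes the value of `k` at a chosen preimage; the compatibility hypotheses make the
  -- value independent of the choice.
  obtain ⟨pV, hpV⟩ : ∃ p : Z.V → X.V, ∀ a, p (g.onV a) = k.onV a :=
    ⟨fun z => k.onV (sV z).choose, fun a => hV _ _ (sV _).choose_spec⟩
  obtain ⟨pE, hpE⟩ : ∃ p : Z.E → X.E, ∀ a, p (g.onE a) = k.onE a :=
    ⟨fun z => k.onE (sE z).choose, fun a => hE _ _ (sE _).choose_spec⟩
  obtain ⟨pF, hpF⟩ : ∃ p : Z.F → X.F, ∀ a, p (g.onF a) = k.onF a :=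
    ⟨fun z => k.onF (sF z).choose, fun a => hF _ _ (sF _).choose_spec⟩
  obtain ⟨pC, hpC⟩ : ∃ p : Z.Corner → X.Corner, ∀ a, p (g.onCorner a) = k.onCorner a :=
    ⟨fun z => k.onCorner (sC z).choose, fun a => hC _ _ (sC _).choose_spec⟩
  let p : Graph.Hom Z.toGraph X.toGraph :=
    { onV := pV
      onE := pE
      src_comm := by
        intro e
        obtain ⟨d, rfl⟩ := sE e
        rw [hpE, g.src_comm, hpV, k.src_comm]
      inv_comm := by
        intro e
        obtain ⟨d, rfl⟩ := sE e
        rw [← g.inv_comm, hpE, hpE, k.inv_comm] }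
  have hp : g.toHom.comp p = k.toHom := Graph.Hom.ext (funext hpV) (funext hpE)
  suffices h : ∃ q : Z ⟶ X, q.toHom = p ∧ ∀ c, q.onCorner c = pC c by
    obtain ⟨q, hq, hqC⟩ := h
    exact ⟨q, Hom.ext_corner (fun v => (congrArg (fun m => m.onV (g.onV v)) hq).trans (hpV v))
        (fun e => (congrArg (fun m => m.onE (g.onE e)) hq).trans (hpE e))
        (fun c => (hqC _).trans (hpC c))⟩
  refine exists_hom_of_onCorner p pF pC ?_ ?_ ?_
  · intro σ
    obtain ⟨σ, rfl⟩ := sF σ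
    -- The sphere map is still existentially quantified, so the face on which its type depends can
    -- be rewritten.
    rw [hpF σ]
    -- The composition law `ε(pg, σ) = ε(p, gσ) ε(g, σ)` leaves no other choice.
    refine ⟨(g.eps σ).symm.trans (k.eps σ), fun j => ?_, ?_⟩
    · obtain ⟨i, rfl⟩ := (g.eps σ).onV.surjective j
      refine Eq.trans ?_ (hpC ⟨σ, i⟩).symm
      exact congrArg (fun i => (⟨k.onF σ, (k.eps σ).onV i⟩ : X.Corner))
        ((g.eps σ).onV.symm_apply_apply i)
    · have h1 := (congrArg (fun m => m.comp p) (g.att_comm σ)).symm.trans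
        ((congrArg (fun m => (Y.bdry σ).att.comp m) hp).trans (k.att_comm σ))
      refine Graph.Hom.ext (funext fun j => ?_) (funext fun j => ?_)
      · obtain ⟨i, rfl⟩ := (g.eps σ).onV.surjective j
        refine (congrArg (fun m => m.onV i) h1).trans ?_
        exact congrArg (fun i => (X.bdry (k.onF σ)).att.onV ((k.eps σ).onV i))
          ((g.eps σ).onV.symm_apply_apply i).symm
      · obtain ⟨i, rfl⟩ := (g.eps σ).onE.surjective j
        refine (congrArg (fun m => m.onE i) h1).trans ?_
        exact congrArg (fun i => (X.bdry (k.onF σ)).att.onE ((k.eps σ).onE i))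
          ((g.eps σ).onE.symm_apply_apply i).symm
  · intro σ
    obtain ⟨σ, rfl⟩ := sF σ
    rw [← g.onF_inv, hpF, hpF, k.onF_inv]
  · intro c
    obtain ⟨c, rfl⟩ := sC c
    rw [← g.onCorner_inv, hpC, hpC, k.onCorner_inv]

/-! ### The Galois group -/

/-- An element of the Galois group which agrees with another one at a vertex is equal to it. -/
theorem IsCovering.gal_eq_of_onV {f : Y ⟶ X} (hf : IsCovering f) (hY : Y.Connected)
    {a b : Gal f} {y : Y.V} (h : a.1.hom.onV y = b.1.hom.onV y) : a = b :=
  Subtype.ext (Iso.ext (hf.lift_unique hY ((Gal_comp_eq a).trans (Gal_comp_eq b).symm) h))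

/-- The Galois group of `f` acts transitively on all vertex fibres. -/
def FibreTransitive (f : Y ⟶ X) : Prop :=
  ∀ y₁ y₂, f.onV y₁ = f.onV y₂ → ∃ a : Gal f, a.1.hom.onV y₁ = y₂

/-- If the Galois group is transitive on one vertex fibre, it is transitive on all of them. -/
theorem IsCovering.fibreTransitive {f : Y ⟶ X} (hf : IsCovering f) (hX : X.Connected) {x : X.V}
    (hx : ∀ y₁ y₂, f.onV y₁ = x → f.onV y₂ = x → ∃ a : Gal f, a.1.hom.onV y₁ = y₂) :
    FibreTransitive f := by
  suffices ∀ w, ∀ y₁ y₂, f.onV y₁ = w → f.onV y₂ = w → ∃ a : Gal f, a.1.hom.onV y₁ = y₂ from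
    fun y₁ y₂ h => this _ y₁ y₂ h rfl
  intro w
  induction hX x w with
  | refl => exact hx
  | tail _ h ih =>
    obtain ⟨e, rfl, rfl⟩ := h
    intro y₁ y₂ h₁ h₂
    -- Lifting the inverse edge at `y₁` and `y₂` leads back to the fibre where transitivity is
    -- known. A deck transformation matching the far ends matches the lifts of `e` by unique
    -- lifting, and so takes `y₁` to `y₂`.
    obtain ⟨d₁, rfl, hd₁⟩ := hf.exists_lift_edge (e := X.inv e) (y := y₁) h₁.symm
    obtain ⟨d₂, rfl, hd₂⟩ := hf.exists_lift_edge (e := X.inv e) (y := y₂) h₂.symm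
    have hi₁ : f.onE (Y.inv d₁) = e := by rw [f.inv_comm, hd₁, X.inv_inv]
    have hi₂ : f.onE (Y.inv d₂) = e := by rw [f.inv_comm, hd₂, X.inv_inv]
    obtain ⟨a, ha⟩ := ih (Y.src (Y.inv d₁)) (Y.src (Y.inv d₂))
      (by rw [← f.src_comm, hi₁]) (by rw [← f.src_comm, hi₂])
    have h3 : a.1.hom.onE (Y.inv d₁) = Y.inv d₂ := by
      refine hf.onE_injective_of_src ?_ ?_
      · rw [a.1.hom.src_comm, ha]
      · rw [Gal_onE_eq, hi₁, hi₂]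
    refine ⟨a, ?_⟩
    have h4 := congrArg Y.tgt h3
    rw [Hom.tgt_comm, Graph.tgt, Graph.tgt, Y.inv_inv, Y.inv_inv] at h4
    exact h4

theorem mem_Gal {f : Y ⟶ X} {a : Aut Y} : a ∈ Gal f ↔ a.hom ≫ f = f := Iff.rfl

/-- If the Galois group of `g` is transitive on vertex fibres, then every map invariant under it
factors through `g`. -/
theorem IsCovering.exists_descent_of_gal {g : Y ⟶ Z} (hg : IsCovering g) (hZ : Z.Connected)
    (hgal : FibreTransitive g) (k : Y ⟶ X)
    (hk : ∀ a ∈ Gal g, a.hom ≫ k = k) : ∃ p : Z ⟶ X, g ≫ p = k := by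
  refine hg.exists_descent hZ k (fun b c h => ?_) (fun b c h => ?_) (fun b c h => ?_)
  · obtain ⟨a, rfl⟩ := hgal b c h
    exact congrArg (fun m : Y ⟶ X => m.onV b) (hk a.1 a.2).symm
  -- Edges with the same image differ by a deck transformation: match their start vertices, and
  -- unique lifting does the rest. Corners are matched by their vertices in the same way.
  · obtain ⟨a, ha⟩ := hgal (Y.src b) (Y.src c) (by rw [← g.src_comm, ← g.src_comm, h])
    have h1 : a.1.hom.onE b = c := hg.onE_injective_of_src (by rw [a.1.hom.src_comm, ha])
      (by rw [Gal_onE_eq, h])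
    rw [← h1]
    exact congrArg (fun m : Y ⟶ X => m.onE b) (hk a.1 a.2).symm
  · obtain ⟨a, ha⟩ := hgal (Y.vert b) (Y.vert c) (by rw [← g.vert_onCorner, ← g.vert_onCorner, h])
    have h1 : a.1.hom.onCorner b = c := hg.onCorner_injective_of_vert
      (by rw [a.1.hom.vert_onCorner, ha]) (by rw [Gal_onCorner_eq, h])
    rw [← h1]
    exact congrArg (fun m : Y ⟶ X => m.onCorner b) (hk a.1 a.2).symm

/-! ### Degrees -/

/-- The fibre of a covering over an edge is in bijection with the fibre over its start. -/
theorem IsCovering.mk_fibre_edge {f : Y ⟶ X} (hf : IsCovering f) (e : X.E) :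
    Cardinal.mk {d : Y.E // f.onE d = e} = Cardinal.mk {y : Y.V // f.onV y = X.src e} := by
  refine Cardinal.mk_congr (Equiv.ofBijective
    (fun d => ⟨Y.src d.1, by rw [← f.src_comm, d.2]⟩) ⟨fun d d' h => ?_, fun y => ?_⟩)
  · exact Subtype.ext (hf.onE_injective_of_src (congrArg Subtype.val h) (d.2.trans d'.2.symm))
  · obtain ⟨d, hd, he⟩ := hf.exists_lift_edge y.2.symm
    exact ⟨⟨d, he⟩, Subtype.ext hd⟩

/-- The fibre of a covering over a corner is in bijection with the fibre over its vertex. -/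
theorem IsCovering.mk_fibre_corner {f : Y ⟶ X} (hf : IsCovering f) (c : X.Corner) :
    Cardinal.mk {d : Y.Corner // f.onCorner d = c} =
      Cardinal.mk {y : Y.V // f.onV y = X.vert c} := by
  refine Cardinal.mk_congr (Equiv.ofBijective
    (fun d => ⟨Y.vert d.1, by rw [← f.vert_onCorner, d.2]⟩) ⟨fun d d' h => ?_, fun y => ?_⟩)
  · exact Subtype.ext (hf.onCorner_injective_of_vert (congrArg Subtype.val h) (d.2.trans d'.2.symm))
  · obtain ⟨d, hd, he⟩ := hf.exists_lift_corner y.2.symm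
    exact ⟨⟨d, he⟩, Subtype.ext hd⟩

/-- The fibre of a map over a face is in bijection with the fibre over any of its corners. -/
theorem TwoComplex.Hom.mk_fibre_face (f : Y ⟶ X) (c : X.Corner) :
    Cardinal.mk {σ : Y.F // f.onF σ = c.1} = Cardinal.mk {d : Y.Corner // f.onCorner d = c} := by
  refine (Cardinal.mk_congr (Equiv.ofBijective
    (fun d => ⟨d.1.1, congrArg Sigma.fst d.2⟩) ⟨fun d d' h => ?_, fun σ => ?_⟩)).symm
  · exact Subtype.ext (f.onCorner_injective_on_face (congrArg Subtype.val h) (d.2.trans d'.2.symm))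
  · obtain ⟨j, hj⟩ := f.exists_corner_of_onF c σ.2
    exact ⟨⟨⟨σ.1, j⟩, hj⟩, rfl⟩

/-- Only vertex fibres have to be counted: an edge is determined in its fibre by its start, and a
face by its corner over the corner `0` of its image, which is in turn determined by its vertex. -/
theorem IsCovering.hasDegree {f : Y ⟶ X} (hf : IsCovering f) {κ : Cardinal.{u}}
    (h : ∀ x, Cardinal.mk {y : Y.V // f.onV y = x} = κ) : HasDegree f κ :=
  ⟨h, fun e => (hf.mk_fibre_edge e).trans (h _), fun τ =>
    (f.mk_fibre_face ⟨τ, (0 : ZMod _)⟩).trans ((hf.mk_fibre_corner _).trans (h _))⟩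

/-! ### Intermediate coverings -/

namespace IntermediateCover

variable {f : Y ⟶ X} {y : Y.V} {x : X.V}

theorem mem_gal {A : IntermediateCover f y x} {a : Gal f} : a ∈ A.gal ↔ a.1.hom ≫ A.g = A.g :=
  Iff.rfl

theorem Gal_g_le (A : IntermediateCover f y x) : Gal A.g ≤ Gal f := by
  intro a ha
  rw [mem_Gal] at ha ⊢
  rw [← A.comp_eq, ← Category.assoc, ha]

theorem comp_eq_of_onV (A : IntermediateCover f y x) (hY : Y.Connected) {s t : Y ⟶ A.Z}
    (hs : s ≫ A.h = f) (ht : t ≫ A.h = f) {w : Y.V} (h : s.onV w = t.onV w) : s = t :=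
  A.h_covering.lift_unique hY (hs.trans ht.symm) h

theorem Gal_comp_comp (A : IntermediateCover f y x) (a : Gal f) : (a.1.hom ≫ A.g) ≫ A.h = f := by
  rw [Category.assoc, A.comp_eq, Gal_comp_eq]

theorem onV_comp (A : IntermediateCover f y x) (w : Y.V) : A.h.onV (A.g.onV w) = f.onV w :=
  congrArg (fun k : Y ⟶ X => k.onV w) A.comp_eq

/-- An element of `Gal(Y, X)` preserving one fibre element of `Y → Z` lies in `Gal(Y, Z)`. -/
theorem mem_gal_of_onV (A : IntermediateCover f y x) (hY : Y.Connected) {a : Gal f} {w : Y.V}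
    (h : A.g.onV (a.1.hom.onV w) = A.g.onV w) : a ∈ A.gal :=
  A.comp_eq_of_onV hY (A.Gal_comp_comp a) A.comp_eq h

/-! ### Intermediate coverings compared through their Galois groups -/

theorem gal_le_of_coveredBy {A B : IntermediateCover f y x} (h : A.CoveredBy B) :
    B.gal ≤ A.gal := by
  obtain ⟨p, -, -, hg, -⟩ := h
  intro a ha
  rw [mem_gal] at ha ⊢
  rw [← hg, ← Category.assoc, ha]

/-- Points identified in `Z` are identified in `X`, so an element of `Gal f` matches them; rigidity
places it in `Gal(Y, Z)`. -/
theorem fibreTransitive_g (A : IntermediateCover f y x) (hY : Y.Connected)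
    (ht : FibreTransitive f) : FibreTransitive A.g := by
  intro y₁ y₂ h
  obtain ⟨a, rfl⟩ := ht y₁ y₂ (by rw [← A.onV_comp, ← A.onV_comp, h])
  exact ⟨⟨a.1, A.mem_gal_of_onV hY h.symm⟩, rfl⟩

/-- The inclusion says that `A.g` is invariant under `Gal B.g`, so it descends along the quotient
map `B.g`. -/
theorem coveredBy_of_gal_le {A B : IntermediateCover f y x} (hY : Y.Connected)
    (ht : FibreTransitive f) (h : B.gal ≤ A.gal) : A.CoveredBy B := by
  obtain ⟨p, hp⟩ := B.g_covering.exists_descent_of_gal B.connected (B.fibreTransitive_g hY ht) A.g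
    fun a ha => h (show (⟨a, B.Gal_g_le ha⟩ : Gal f) ∈ B.gal from ha)
  refine ⟨p, B.g_covering.of_comp B.connected (hp ▸ A.g_covering), ?_, hp, ?_⟩
  · rw [← B.g_pt, ← A.g_pt, ← hp, TwoComplex.comp_onV]
  · refine B.g_covering.cancel B.connected ?_
    rw [← Category.assoc, hp, A.comp_eq, B.comp_eq]

theorem coveredBy_iff {A B : IntermediateCover f y x} (hY : Y.Connected)
    (ht : FibreTransitive f) : A.CoveredBy B ↔ B.gal ≤ A.gal :=
  ⟨gal_le_of_coveredBy, coveredBy_of_gal_le hY ht⟩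

theorem equivalent_of_gal_eq {A B : IntermediateCover f y x} (hY : Y.Connected)
    (ht : FibreTransitive f) (h : A.gal = B.gal) : A.Equivalent B :=
  equivalent_of_coveredBy (coveredBy_of_gal_le hY ht h.ge) (coveredBy_of_gal_le hY ht h.le)

/-- A deck transformation over `Y / H` moves `y` within its `H`-orbit, hence agrees at `y` with an
element of `H`, and by rigidity equals it. -/
theorem gal_quotCover (hf : IsCovering f) (hY : Y.Connected) (hyx : f.onV y = x)
    (H : Subgroup (Gal f)) : (quotCover H hf hY hyx).gal = H := by
  ext a
  constructor
  · intro ha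
    have ha' : a.1.hom ≫ quotMap f H = quotMap f H := ha
    obtain ⟨b, hb⟩ := quotMap_onV_eq H (x := a.1.hom.onV y) (y := y)
      (congrArg (fun k : Y ⟶ quot f H => k.onV y) ha')
    rw [← hf.gal_eq_of_onV hY (a := b.1) (b := a) (y := y) hb]
    exact b.2
  · intro ha
    exact Hom.ext_corner (fun v => Quotient.sound ⟨⟨a, ha⟩, rfl⟩)
      (fun e => quotMap_onE_smul H ⟨a, ha⟩ e) (fun c => quotMap_onCorner_smul H ⟨a, ha⟩ c)

/-! ### Normal subgroups and Galois intermediate coverings -/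

/-- Conjugation by `a` preserves `Gal(Y, Z)` if `a` descends to `Z`. -/
theorem conj_mem_gal {A : IntermediateCover f y x} {a b : Gal f} {p : A.Z ⟶ A.Z}
    (hp : A.g ≫ p = a.1.hom ≫ A.g) (hb : b ∈ A.gal) : a * b * a⁻¹ ∈ A.gal := by
  have hb' : b.1.hom ≫ A.g = A.g := hb
  -- The product in `Aut Y` is composition of functions, the reverse of the diagrammatic order.
  change (a.1.inv ≫ b.1.hom ≫ a.1.hom) ≫ A.g = A.g
  rw [Category.assoc, Category.assoc, ← hp, ← Category.assoc b.1.hom, hb', hp]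
  exact a.1.inv_hom_id_assoc A.g

/-- If `Gal(Y, Z)` is normal, every element of `Gal(Y, X)` descends to `Z`. -/
theorem exists_descent_of_normal (A : IntermediateCover f y x) (hY : Y.Connected)
    (ht : FibreTransitive f) (hn : A.gal.Normal) (a : Gal f) :
    ∃ p : A.Z ⟶ A.Z, A.g ≫ p = a.1.hom ≫ A.g := by
  refine A.g_covering.exists_descent_of_gal A.connected (A.fibreTransitive_g hY ht) _ fun b hb => ?_
  -- Cancelling `a.1.inv` turns normality into invariance of `a.1.hom ≫ A.g` under `b`.
  have h1 : (a.1.inv ≫ b.hom ≫ a.1.hom) ≫ A.g = A.g :=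
    hn.conj_mem ⟨b, A.Gal_g_le hb⟩ hb a
  rw [Category.assoc, Category.assoc] at h1
  exact (Iso.inv_comp_eq (α := (a.1 : Y ≅ Y))).mp h1

/-- Both conditions amount to the descent of every element of `Gal f` to `Z`. Descended elements act
transitively on the fibres of `Z → X` because `Gal f` does on those of `Y → X`. -/
theorem isGaloisVia_iff_normal (A : IntermediateCover f y x) (hY : Y.Connected)
    (hX : X.Connected) (hf : IsCovering f) (ht : FibreTransitive f) (w : X.V) :
    IsGaloisVia A.h w ↔ A.gal.Normal := by
  constructor
  · intro hw
    refine ⟨fun b hb a => ?_⟩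
    obtain ⟨v, rfl⟩ := hf.surjective_onV hX w
    -- `p` is chosen to act as `a` would at one point; then `A.g ≫ p` and `a ≫ A.g` are lifts of `f`
    -- that agree at `v`, so `a` descends to `p`.
    obtain ⟨p, hp, -⟩ := hw (A.g.onV v) (A.g.onV (a.1.hom.onV v)) (A.onV_comp v)
      (by rw [A.onV_comp, Gal_onV_eq])
    refine conj_mem_gal (p := p.1.hom) (A.comp_eq_of_onV hY ?_ (A.Gal_comp_comp a) hp) hb
    rw [Category.assoc, Gal_comp_eq, A.comp_eq]
  · intro hn z₁ z₂ h₁ h₂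
    obtain ⟨y₁, rfl⟩ := A.g_covering.surjective_onV A.connected z₁
    obtain ⟨y₂, rfl⟩ := A.g_covering.surjective_onV A.connected z₂
    obtain ⟨a, rfl⟩ := ht y₁ y₂ (by rw [← A.onV_comp, ← A.onV_comp, h₁, h₂])
    obtain ⟨p, hp⟩ := A.exists_descent_of_normal hY ht hn a
    -- The descent of `a⁻¹` is inverse to that of `a`, since `A.g` is an epimorphism.
    obtain ⟨q, hq⟩ := A.exists_descent_of_normal hY ht hn a⁻¹
    have hq' : A.g ≫ q = a.1.inv ≫ A.g := hq
    have hpq : p ≫ q = 𝟙 A.Z := A.g_covering.cancel A.connected (by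
      rw [← Category.assoc, hp, Category.assoc, hq', Category.comp_id]
      exact a.1.hom_inv_id_assoc A.g)
    have hqp : q ≫ p = 𝟙 A.Z := A.g_covering.cancel A.connected (by
      rw [← Category.assoc, hq', Category.assoc, hp, Category.comp_id]
      exact a.1.inv_hom_id_assoc A.g)
    have hph : p ≫ A.h = A.h := A.g_covering.cancel A.connected (by
      rw [← Category.assoc, hp, A.Gal_comp_comp, A.comp_eq])
    have hpy : p.onV (A.g.onV y₁) = A.g.onV (a.1.hom.onV y₁) :=
      congrArg (fun k : Y ⟶ A.Z => k.onV y₁) hp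
    exact ⟨⟨⟨p, q, hpq, hqp⟩, hph⟩, hpy, fun b hb =>
      A.h_covering.gal_eq_of_onV A.connected (hb.trans hpy.symm)⟩

/-! ### Degree and index -/

/-- The degree of `Z → X` is the index of `Gal(Y, Z)` in `Gal(Y, X)`. -/
theorem hasDegree_h (A : IntermediateCover f y x) (hY : Y.Connected) (hX : X.Connected)
    (hf : IsCovering f) (ht : FibreTransitive f) :
    HasDegree A.h (Cardinal.mk (Gal f ⧸ A.gal)) := by
  refine A.h_covering.hasDegree fun w => ?_
  obtain ⟨v, rfl⟩ := hf.surjective_onV hX w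
  -- `A.g` is unchanged by `A.gal` acting on the left, whereas the quotient consists of left cosets
  -- `a * A.gal`; hence the inverses. The element `a⁻¹ * b` carries `b⁻¹ v` to `a⁻¹ v`.
  have key : ∀ a b : Gal f, A.g.onV (a⁻¹.1.hom.onV v) = A.g.onV (b⁻¹.1.hom.onV v) ↔
      a⁻¹ * b ∈ A.gal := by
    intro a b
    have hb : b.1.hom.onV (b⁻¹.1.hom.onV v) = v :=
      congrArg (fun k : Y ⟶ Y => k.onV v) b.1.inv_hom_id
    have h1 : (a⁻¹ * b).1.hom.onV (b⁻¹.1.hom.onV v) = a⁻¹.1.hom.onV v :=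
      congrArg a⁻¹.1.hom.onV hb
    rw [← h1]
    exact ⟨A.mem_gal_of_onV hY, fun h => congrArg (fun k : Y ⟶ A.Z => k.onV _) h⟩
  refine (Cardinal.mk_congr (Equiv.ofBijective (Quotient.lift
    (fun a : Gal f => (⟨A.g.onV (a⁻¹.1.hom.onV v), by rw [A.onV_comp, Gal_onV_eq]⟩ :
      {z : A.Z.V // A.h.onV z = f.onV v})) fun a b hab =>
        Subtype.ext ((key a b).mpr (QuotientGroup.leftRel_apply.mp hab))) ⟨?_, ?_⟩)).symm
  · rintro ⟨a⟩ ⟨b⟩ h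
    exact Quotient.sound (QuotientGroup.leftRel_apply.mpr
      ((key a b).mp (congrArg Subtype.val h)))
  · rintro ⟨z, hz⟩
    obtain ⟨u, rfl⟩ := A.g_covering.surjective_onV A.connected z
    obtain ⟨a, rfl⟩ := ht v u (by rw [← A.onV_comp u, hz])
    exact ⟨Quotient.mk _ a⁻¹, Subtype.ext (by
      change A.g.onV (a⁻¹⁻¹.1.hom.onV v) = _
      rw [inv_inv])⟩

/-! ### The correspondence -/

/-- The order anti-isomorphism between classes of intermediate coverings and subgroups of the
Galois group. -/
def galOrderIso (hY : Y.Connected) (hf : IsCovering f) (ht : FibreTransitive f)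
    (hyx : f.onV y = x) : IntermediateCovers f y x ≃o (Subgroup (Gal f))ᵒᵈ where
  toFun := Quotient.lift (fun A => OrderDual.toDual A.gal) fun _ _ h =>
    congrArg OrderDual.toDual (le_antisymm (gal_le_of_coveredBy h.coveredBy)
      (gal_le_of_coveredBy h.symm.coveredBy))
  invFun H := (quotCover (OrderDual.ofDual H) hf hY hyx).cls
  left_inv := by
    rintro ⟨A⟩
    -- `Z` and `Y / Gal(Y, Z)` have the same Galois group, which determines the class.
    exact Quotient.sound (equivalent_of_gal_eq hY ht (gal_quotCover hf hY hyx A.gal))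
  right_inv H := gal_quotCover hf hY hyx (OrderDual.ofDual H)
  map_rel_iff' := by
    rintro ⟨A⟩ ⟨B⟩
    exact (coveredBy_iff hY ht).symm

end IntermediateCover

end CombTop

open IntermediateCover

theorem mainTheorem1 {Y X : TwoComplex.{u}} (hY : Y.Connected) (hX : X.Connected)
    (f : Y ⟶ X) (hf : IsCovering f) (y : Y.V) (x : X.V) (hyx : f.onV y = x)
    (hGal : IsGaloisVia f x) :
    ∃ Φ : IntermediateCovers f y x ≃o (Subgroup (Gal f))ᵒᵈ,
      -- `Φ` sends the class of `Y → Z → X` to `Gal(Y, Z)`, and its inverse sends `H` to `Y / H`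
      (∀ A : IntermediateCover f y x, Φ A.cls = OrderDual.toDual A.gal) ∧
      (∀ H : Subgroup (Gal f),
        Φ.symm (OrderDual.toDual H) = (quotCover H hf hY hyx).cls) ∧
      -- the poset of intermediate coverings is a lattice; joins go to meets and meets to joins
      (∀ a b : IntermediateCovers f y x, ∃ j, IsLUB {a, b} j ∧
        OrderDual.ofDual (Φ j) = OrderDual.ofDual (Φ a) ⊓ OrderDual.ofDual (Φ b)) ∧
      (∀ a b : IntermediateCovers f y x, ∃ m, IsGLB {a, b} m ∧
        OrderDual.ofDual (Φ m) = OrderDual.ofDual (Φ a) ⊔ OrderDual.ofDual (Φ b)) ∧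
      -- the two composites are the identity, on representatives
      (∀ H : Subgroup (Gal f), (quotCover H hf hY hyx).gal = H) ∧
      (∀ A : IntermediateCover f y x, A.Equivalent (quotCover A.gal hf hY hyx)) ∧
      -- `Z → X` is Galois iff `Gal(Y, Z)` is normal
      (∀ (A : IntermediateCover f y x) (w : X.V), IsGaloisVia A.h w ↔ A.gal.Normal) ∧
      -- the degree of `Z → X` is the index of `Gal(Y, Z)`
      (∀ A : IntermediateCover f y x, HasDegree A.h (Cardinal.mk (Gal f ⧸ A.gal))) ∧
      -- the degree of `Y / H → X` is the index of `H`
      (∀ H : Subgroup (Gal f),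
        HasDegree (quotCover H hf hY hyx).h (Cardinal.mk (Gal f ⧸ H))) := by
  -- Freeness of the action is automatic by rigidity; the content of regularity is transitivity.
  have ht : FibreTransitive f :=
    hf.fibreTransitive hX fun y₁ y₂ h₁ h₂ => (hGal y₁ y₂ h₁ h₂).exists
  let Φ := galOrderIso hY hf ht hyx
  -- Joins and meets are pulled back along `Φ`. In the order dual `⊔` is the intersection of
  -- subgroups and `⊓` is the subgroup they generate.
  refine ⟨Φ, fun _ => rfl, fun _ => rfl, fun a b => ⟨Φ.symm (Φ a ⊔ Φ b), ?_, ?_⟩,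
    fun a b => ⟨Φ.symm (Φ a ⊓ Φ b), ?_, ?_⟩, gal_quotCover hf hY hyx,
    fun A => equivalent_of_gal_eq hY ht (gal_quotCover hf hY hyx A.gal).symm,
    fun A w => A.isGaloisVia_iff_normal hY hX hf ht w, fun A => A.hasDegree_h hY hX hf ht,
    fun H => ?_⟩
  · rw [← Φ.isLUB_image', Set.image_pair, Φ.apply_symm_apply]
    exact isLUB_pair
  · rw [Φ.apply_symm_apply]; rfl
  · rw [← Φ.isGLB_image', Set.image_pair, Φ.apply_symm_apply]
    exact isGLB_pair
  · rw [Φ.apply_symm_apply]; rfl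
  · have := (quotCover H hf hY hyx).hasDegree_h hY hX hf ht
    rwa [gal_quotCover] at this
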